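/- For $r\ge 1$ let $F_r$ be the free group of rank $r$; for $g\ge 1$ let $S_g=\langle a_1,b_1,\dots,a_g,b_g \mid [a_1,b_1]\cdots[a_g,b_g]\rangle$ (with $[x,y]=xyx^{-1}y^{-1}$) be the fundamental group of the closed orientable surface of genus $g$; for $k\ge 1$ let $NS_k=\langle a_1,\dots,a_k \mid a_1^2\cdots a_k^2\rangle$ be the fundamental group of the connected sum of $k$ projective planes. For a finitely generated group $G$, write $\mathrm{rk}$ for the minimal number of generators (possibly infinite for subgroups), and call a subgroup $H\le G$ inert in $G$ if $\mathrm{rk}(K\cap H)\le \mathrm{rk}(K)$ for every finitely generated subgroup $K\le G$. For $\varphi\in\mathrm{Aut}(G)$ let $\mathrm{Fix}\,\varphi=\{x\in G \mid \varphi(x)=x\}$. Theorem. Let $G=G_1\times\cdots\times G_n$, $n\ge 1$, where each $G_i$ is isomorphic to $F_r$, $S_g$ or $NS_k$ for some $r\ge1$, $g\ge 1$ or $k\ge 1$, respectively. If $\mathrm{Fix}\,\varphi$ is inert in $G$ for every automorphism $\varphi\in\mathrm{Aut}(G)$, then $G$ is isomorphic to a group of one of the following forms: (euc1) $\mathbb{Z}^p\times(\mathbb{Z}/2\mathbb{Z})^q$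 for some $p,q\ge 0$; (euc2) $NS_2\times(\mathbb{Z}/2\mathbb{Z})^q$ for some $q\ge 0$; (euc3) $NS_2\times\mathbb{Z}^p\times(\mathbb{Z}/2\mathbb{Z})$ for some $p\ge 1$; (euc4) $NS_2^{\,\ell}\times\mathbb{Z}^p$ for some $\ell\ge 1$, $p\ge 0$; (hyp1$'$) $F_r$ for some $r\ge 2$; (hyp2$'$) $S_g$ for some $g\ge 2$; (hyp3$'$) $NS_k$ for some $k\ge 3$. -/

import Mathlib

namespace ProductGroups

/-- The relator `[a₁,b₁]⋯[a_g,b_g]`, where `[x,y] = x y x⁻¹ y⁻¹`; the generators `aᵢ`, `bᵢ` are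
indexed by the left and the right copy of `Fin g`. -/
def orientableRelator (g : ℕ) : FreeGroup (Fin g ⊕ Fin g) :=
  (List.ofFn fun i : Fin g =>
    let a : FreeGroup (Fin g ⊕ Fin g) := FreeGroup.of (Sum.inl i)
    let b : FreeGroup (Fin g ⊕ Fin g) := FreeGroup.of (Sum.inr i)
    a * b * a⁻¹ * b⁻¹).prod

/-- The relator `a₁² a₂² ⋯ a_k²`. -/
def nonorientableRelator (k : ℕ) : FreeGroup (Fin k) :=
  (List.ofFn fun i : Fin k => FreeGroup.of i ^ 2).prod

/-- `S_g`, the fundamental group of the closed orientable surface of genus `g`. -/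
abbrev OrientableSurfaceGroup (g : ℕ) : Type :=
  PresentedGroup ({orientableRelator g} : Set (FreeGroup (Fin g ⊕ Fin g)))

/-- `NS_k`, the fundamental group of the connected sum of `k` projective planes. -/
abbrev NonorientableSurfaceGroup (k : ℕ) : Type :=
  PresentedGroup ({nonorientableRelator k} : Set (FreeGroup (Fin k)))

/-- The admissible factors of a product group: the groups isomorphic to `F_r` with `r ≥ 1`,
`S_g` with `g ≥ 1`, or `NS_k` with `k ≥ 1`. -/
def IsFactorGroup (A : Type*) [Group A] : Prop :=
  (∃ r : ℕ, 1 ≤ r ∧ Nonempty (A ≃* FreeGroup (Fin r))) ∨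
  (∃ g : ℕ, 1 ≤ g ∧ Nonempty (A ≃* OrientableSurfaceGroup g)) ∨
  (∃ k : ℕ, 1 ≤ k ∧ Nonempty (A ≃* NonorientableSurfaceGroup k))

/-- The fixed subgroup `{x | φ x = x}` of an automorphism. -/
def fixedSubgroup {G : Type*} [Group G] (φ : MulAut G) : Subgroup G :=
  (φ.toMonoidHom).eqLocus (MonoidHom.id G)

/-- `H` is inert in `G` if `rk (K ∩ H) ≤ rk K` for every finitely generated subgroup `K` of `G`.
As `rk K` is finite, the inequality includes that `K ∩ H` is finitely generated. -/
def IsInert {G : Type*} [Group G] (H : Subgroup G) : Prop :=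
  ∀ (K : Subgroup G) [Group.FG K],
    ∃ _ : Group.FG (K ⊓ H : Subgroup G), Group.rank (K ⊓ H : Subgroup G) ≤ Group.rank K

/-- `Z^p`, written multiplicatively. -/
abbrev ZPow (p : ℕ) : Type := Fin p → Multiplicative ℤ

/-- `(Z/2Z)^q`, written multiplicatively. -/
abbrev ZTwoPow (q : ℕ) : Type := Fin q → Multiplicative (ZMod 2)

/-- Form (euc1): `Z^p × (Z/2Z)^q` with `p, q ≥ 0`. -/
def IsEuc1 (G : Type*) [Group G] : Prop :=
  ∃ p q : ℕ, Nonempty (G ≃* ZPow p × ZTwoPow q)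

/-- Form (euc2): `NS_2 × (Z/2Z)^q` with `q ≥ 0`. -/
def IsEuc2 (G : Type*) [Group G] : Prop :=
  ∃ q : ℕ, Nonempty (G ≃* NonorientableSurfaceGroup 2 × ZTwoPow q)

/-- Form (euc3): `NS_2 × Z^p × Z/2Z` with `p ≥ 1`. -/
def IsEuc3 (G : Type*) [Group G] : Prop :=
  ∃ p : ℕ, 1 ≤ p ∧
    Nonempty (G ≃* NonorientableSurfaceGroup 2 × ZPow p × Multiplicative (ZMod 2))

/-- Form (euc4): `NS_2^l × Z^p` with `l ≥ 1`, `p ≥ 0`. -/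
def IsEuc4 (G : Type*) [Group G] : Prop :=
  ∃ l p : ℕ, 1 ≤ l ∧ Nonempty (G ≃* (Fin l → NonorientableSurfaceGroup 2) × ZPow p)

end ProductGroups

namespace ProductGroups

open Subgroup

/-! Each case to be excluded has an automorphism `φ` and a finitely generated `K` such that `K ∩ Fix
φ` maps onto a vector space of dimension larger than a generating set of `K`. A hyperbolic factor
`H` (`F_r` with r ≥ 2, `S_g` with g ≥ 2, `NS_k` with k ≥ 3) admits no nontrivial complement `A`.
Taking for `K` the graph of a homomorphism `H → A`, `exists_index_of_nontrivial` realises the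
preimage of `mℤ` under any `H → ℤ` as `K ∩ Fix φ`, for some m ≠ 1 depending only on `A`. Such
preimages need too many generators (infinitely many if m = 0), as lamplighter quotients of `H` show:
`HasLampQuotients.not_fixRankBounded_prod`. The other factors are ℤ, ℤ², ℤ/2 and `NS_2`, so without
hyperbolic factors `G` is `NS_2^l × ℤ^p × (ℤ/2)^q`. If l, q ≥ 1 and l ≥ 2 or p ≥ 1, a two-generator
`K` meets a fixed subgroup in rank at least 3: `not_fixRankBounded_of_dihedral`. What survives is
(euc1), (euc2) or (euc4); (euc3) never occurs. -/

/-- Every subgroup `K` generated by a finite set `S` meets every fixed subgroup in a subgroup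
generated by at most `S.card` elements. -/
def FixRankBounded (G : Type*) [Group G] : Prop :=
  ∀ (φ : MulAut G) (S : Finset G), ∃ T : Finset G, T.card ≤ S.card ∧
    closure (T : Set G) = closure (S : Set G) ⊓ fixedSubgroup φ

/-! ### Inertness through finite generating sets, and linear lower bounds on rank -/

theorem mem_fixedSubgroup {G : Type*} [Group G] {φ : MulAut G} {x : G} :
    x ∈ fixedSubgroup φ ↔ φ x = x := Iff.rfl

theorem fixRankBounded_of_isInert {G : Type*} [Group G]
    (h : ∀ φ : MulAut G, IsInert (fixedSubgroup φ)) : FixRankBounded G := by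
  classical
  intro φ S
  obtain ⟨hfg, hle⟩ := h φ (closure (S : Set G))
  obtain ⟨T, hT, hcl⟩ := Group.rank_spec (closure (S : Set G) ⊓ fixedSubgroup φ : Subgroup G)
  refine ⟨T.image Subtype.val, Finset.card_image_le.trans ?_, ?_⟩
  · rw [hT]
    exact hle.trans (rank_closure_finset_le_card S)
  · have := congrArg (Subgroup.map (Subgroup.subtype _)) hcl
    rw [MonoidHom.map_closure, ← MonoidHom.range_eq_map, Subgroup.range_subtype] at this
    simpa using this

theorem FixRankBounded.congr {G G' : Type*} [Group G] [Group G'] (e : G ≃* G')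
    (h : FixRankBounded G) : FixRankBounded G' := by
  classical
  intro φ S
  obtain ⟨T, hT, hcl⟩ := h ((e.trans φ).trans e.symm) (S.image e.symm)
  refine ⟨T.image e, Finset.card_image_le.trans (hT.trans Finset.card_image_le), ?_⟩
  have hmap := congrArg (Subgroup.map e.toMonoidHom) hcl
  rw [MonoidHom.map_closure, Subgroup.map_inf _ _ _ e.injective, MonoidHom.map_closure] at hmap
  have hS : (e.toMonoidHom : G → G') '' ((S.image e.symm : Finset G) : Set G) = S := by
    ext x; simp
  have hF : Subgroup.map e.toMonoidHom (fixedSubgroup ((e.trans φ).trans e.symm)) =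
      fixedSubgroup φ := by
    ext x
    simp only [Subgroup.mem_map, mem_fixedSubgroup]
    constructor
    · rintro ⟨y, hy, rfl⟩
      have : e.symm (φ (e y)) = y := hy
      simpa [MulEquiv.symm_apply_eq] using this
    · intro hx
      refine ⟨e.symm x, ?_, by simp⟩
      change e.symm (φ (e (e.symm x))) = e.symm x
      simp [hx]
  rw [hS, hF] at hmap
  simpa using hmap

/-- A subgroup with a function to `ι → F` that is additive on it and whose values span needs at
least `card ι` generators. -/
theorem card_le_of_closure_eq {G F ι : Type*} [Group G] [Field F] [Fintype ι] [DecidableEq ι]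
    {N : Subgroup G} {T : Finset G} (hT : closure (T : Set G) = N) (f : G → ι → F)
    (hf : ∀ x ∈ N, ∀ y ∈ N, f (x * y) = f x + f y)
    (hspan : ∀ i, Pi.single i 1 ∈ Submodule.span F (f '' N)) : Fintype.card ι ≤ T.card := by
  classical
  have h1 : f 1 = 0 := by
    have := hf 1 N.one_mem 1 N.one_mem
    simpa using this
  -- Additivity is only available on `N`, which suffices because `T` generates `N`.
  have hle : Submodule.span F (f '' N) ≤ Submodule.span F ((T.image f : Finset (ι → F)) : Set _) := by
    rw [Submodule.span_le]
    rintro _ ⟨x, hx, rfl⟩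
    rw [← hT] at hf hx
    induction hx using closure_induction with
    | mem x hx => exact Submodule.subset_span (by simpa using ⟨x, hx, rfl⟩)
    | one => rw [h1]; exact Submodule.zero_mem _
    | mul x y hx hy ihx ihy => rw [hf x hx y hy]; exact Submodule.add_mem _ ihx ihy
    | inv x hx ih =>
      have := hf x hx x⁻¹ (inv_mem hx)
      rw [mul_inv_cancel, h1] at this
      rw [eq_neg_of_add_eq_zero_right this.symm]
      exact Submodule.neg_mem _ ih
  have htop : Submodule.span F ((T.image f : Finset (ι → F)) : Set (ι → F)) = ⊤ := by
    rw [eq_top_iff, ← (Pi.basisFun F ι).span_eq, Submodule.span_le]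
    rintro _ ⟨i, rfl⟩
    simpa using hle (hspan i)
  have := finrank_span_finset_le_card (R := F) (T.image f)
  rw [Set.finrank, htop, finrank_top, Module.finrank_fintype_fun_eq_card] at this
  exact this.trans Finset.card_image_le

/-! ### Preimages of `mℤ` as fixed parts of graphs -/

/-- For a nontrivial group `A` there is a single `m ≠ 1` such that boundedness for `H × A` bounds
the number of generators of the preimage of `m ℤ` under every homomorphism `H → ℤ`. -/
theorem exists_index_of_nontrivial {H : Type*} (A : Type*) [Group H] [Group A] [Nontrivial A]
    (hb : FixRankBounded (H × A)) :
    ∃ m : ℕ, m ≠ 1 ∧ ∀ (l : H →* Multiplicative ℤ) (S : Finset H), closure (S : Set H) = ⊤ →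
      ∃ T : Finset H, T.card ≤ S.card ∧
        ∀ h, h ∈ closure (T : Set H) ↔ (m : ℤ) ∣ (l h).toAdd := by
  classical
  -- `K` is the graph of `γ`, an isomorphic copy of `H`; projecting to `H` carries `K ∩ Fix φ` to a
  -- subgroup of `H`.
  have key : ∀ (γ : H →* A) (φ : MulAut (H × A)) (S : Finset H), closure (S : Set H) = ⊤ →
      ∃ T : Finset H, T.card ≤ S.card ∧
        ∀ h, h ∈ closure (T : Set H) ↔ φ (h, γ h) = (h, γ h) := by
    intro γ φ S hS
    let ι : H →* H × A := (MonoidHom.id H).prod γ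
    obtain ⟨T, hT, hcl⟩ := hb φ (S.image ι)
    refine ⟨T.image Prod.fst, Finset.card_image_le.trans (hT.trans Finset.card_image_le), ?_⟩
    have hK : closure ((S.image ι : Finset (H × A)) : Set (H × A)) = ι.range := by
      rw [Finset.coe_image, ← MonoidHom.map_closure, hS, MonoidHom.range_eq_map]
    have hcl' : closure ((T.image Prod.fst : Finset H) : Set H) =
        (closure (T : Set (H × A))).map (MonoidHom.fst H A) := by
      rw [MonoidHom.map_closure, Finset.coe_image]; rfl
    intro h
    rw [hcl', hcl, hK]
    constructor
    · rintro ⟨_, ⟨⟨k, rfl⟩, hk⟩, rfl⟩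
      exact hk
    · intro hh
      exact ⟨ι h, ⟨⟨h, rfl⟩, hh⟩, rfl⟩
  by_cases hA : ∃ (ψ : MulAut A) (d : A), ψ d ≠ d
  · obtain ⟨ψ, d, hd⟩ := hA
    let M : AddSubgroup ℤ :=
      Subgroup.toAddSubgroup' ((fixedSubgroup ψ).comap (zpowersHom A d))
    have hM : ∀ k : ℤ, k ∈ M ↔ ψ (d ^ k) = d ^ k := fun k => Iff.rfl
    -- The exponents `k` with `d ^ k` fixed by `ψ` form `aℤ`. Here a = 0 is possible, but not a =
    -- ±1, since `ψ` moves `d`.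
    obtain ⟨a, ha⟩ := Int.subgroup_cyclic M
    rw [← AddSubgroup.zmultiples_eq_closure] at ha
    have hM' : ∀ k : ℤ, ((a.natAbs : ℕ) : ℤ) ∣ k ↔ ψ (d ^ k) = d ^ k := by
      intro k
      rw [← hM, ha, Int.mem_zmultiples_iff, Int.natAbs_dvd]
    refine ⟨a.natAbs, ?_, ?_⟩
    · intro h1
      have := (hM' 1).1 (by simp [h1])
      exact hd (by simpa using this)
    · intro l S hS
      obtain ⟨T, hT, h⟩ := key ((zpowersHom A d).comp l)
        (MulEquiv.prodCongr (MulEquiv.refl H) ψ) S hS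
      refine ⟨T, hT, fun x => ?_⟩
      rw [h, hM']
      change (x, ψ (d ^ (l x).toAdd)) = (x, d ^ (l x).toAdd) ↔ _
      rw [Prod.mk.injEq, and_iff_right rfl]
  -- If `A` has no nontrivial automorphism, conjugations and inversion are trivial, so `A` is
  -- abelian of exponent 2. A shear by `γ` then replaces `ψ`, with `K = H × 1` and m = 2.
  · push Not at hA
    have hcomm : ∀ a b : A, a * b = b * a := by
      intro a b
      have := hA (MulAut.conj a) b
      rw [MulAut.conj_apply] at this
      exact mul_inv_eq_iff_eq_mul.1 this
    let : CommGroup A := { ‹Group A› with mul_comm := hcomm }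
    have hinv : ∀ a : A, a * a = 1 := fun a => by
      have := hA (MulEquiv.inv A) a
      rw [MulEquiv.inv_apply] at this
      nth_rw 1 [← this]
      simp
    obtain ⟨d, hd⟩ := exists_ne (1 : A)
    refine ⟨2, by norm_num, ?_⟩
    intro l S hS
    let γ : H →* A := (zpowersHom A d).comp l
    let φ : MulAut (H × A) :=
      { toFun := fun p => (p.1, p.2 * γ p.1)
        invFun := fun p => (p.1, p.2 * γ p.1)
        left_inv := fun p => by simp [mul_assoc, hinv]
        right_inv := fun p => by simp [mul_assoc, hinv]
        map_mul' := fun p q => by simp [mul_mul_mul_comm] }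
    obtain ⟨T, hT, h⟩ := key 1 φ S hS
    refine ⟨T, hT, fun x => ?_⟩
    rw [h]
    have h1 : φ (x, (1 : H →* A) x) = (x, γ x) := by simp [φ]
    have ho : orderOf d = 2 := orderOf_eq_prime (by rw [pow_two, hinv]) hd
    rw [h1, MonoidHom.one_apply, Prod.mk.injEq]
    simp only [true_and]
    rw [show γ x = d ^ (l x).toAdd from rfl, ← orderOf_dvd_iff_zpow_eq_one, ho]

/-! ### Lamplighter quotients -/

/-- The product of `J → ZMod 2` wreathed with `ℤ` acting by translation on `ZMod m`, with an
elementary abelian group `E → ZMod 2`. -/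
@[ext]
structure Lamp (m : ℕ) (J E : Type*) where
  val : ZMod m → J → ZMod 2
  pos : ℤ
  aux : E → ZMod 2

namespace Lamp

variable {m : ℕ} {J E : Type*}

instance : Mul (Lamp m J E) :=
  ⟨fun x y => ⟨fun c => x.val c + y.val (c - x.pos), x.pos + y.pos, x.aux + y.aux⟩⟩

instance : One (Lamp m J E) := ⟨⟨0, 0, 0⟩⟩

instance : Inv (Lamp m J E) := ⟨fun x => ⟨fun c => -x.val (c + x.pos), -x.pos, -x.aux⟩⟩

@[simp] theorem one_val : (1 : Lamp m J E).val = 0 := rfl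
@[simp] theorem one_pos : (1 : Lamp m J E).pos = 0 := rfl
@[simp] theorem one_aux : (1 : Lamp m J E).aux = 0 := rfl
@[simp] theorem mul_val (x y : Lamp m J E) :
    (x * y).val = fun c => x.val c + y.val (c - x.pos) := rfl
@[simp] theorem mul_pos (x y : Lamp m J E) : (x * y).pos = x.pos + y.pos := rfl
@[simp] theorem mul_aux (x y : Lamp m J E) : (x * y).aux = x.aux + y.aux := rfl
@[simp] theorem inv_val (x : Lamp m J E) : x⁻¹.val = fun c => -x.val (c + x.pos) := rfl
@[simp] theorem inv_pos (x : Lamp m J E) : x⁻¹.pos = -x.pos := rfl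
@[simp] theorem inv_aux (x : Lamp m J E) : x⁻¹.aux = -x.aux := rfl

instance : Group (Lamp m J E) :=
  Group.ofLeftAxioms
    (fun x y z => by
      ext <;> simp [add_assoc, sub_sub])
    (fun x => by ext <;> simp)
    (fun x => by ext <;> simp [CharTwo.add_self_eq_zero])

/-- The position of the lamplighter. -/
def posHom : Lamp m J E →* Multiplicative ℤ where
  toFun x := Multiplicative.ofAdd x.pos
  map_one' := rfl
  map_mul' _ _ := rfl

variable (m J E)

/-- The step of the lamplighter. -/
def step : Lamp m J E := ⟨0, 1, 0⟩

variable {J}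

/-- Lamp `i` switched on at position `c`. -/
def lampAt [DecidableEq J] (c : ZMod m) (i : J) : Lamp m J E := ⟨Pi.single c (Pi.single i 1), 0, 0⟩

variable (J) {E}

/-- A generator of the elementary abelian factor. -/
def auxAt [DecidableEq E] (i : E) : Lamp m J E := ⟨0, 0, Pi.single i 1⟩

variable {m J}

theorem step_zpow (k : ℤ) : (step m J E) ^ k = ⟨0, k, 0⟩ := by
  induction k using Int.induction_on with
  | zero => rfl
  | succ i ih =>
    rw [zpow_add_one, ih]
    ext <;> simp [step]
  | pred i ih =>
    rw [zpow_sub_one, ih]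
    ext <;> simp [step, sub_eq_add_neg]

theorem step_zpow_conj [DecidableEq J] (k : ℤ) (i : J) :
    (step m J E) ^ k * lampAt m E 0 i * ((step m J E) ^ k)⁻¹ = lampAt m E (k : ZMod m) i := by
  rw [step_zpow]
  ext c j
  · by_cases h : c = (k : ZMod m)
    · simp [lampAt, h]
    · simp [lampAt, h, sub_eq_zero]
  · simp [lampAt]
  · simp [lampAt]

end Lamp

/-- `H` has, for every `m`, a lamplighter quotient of modulus `m` that is large in comparison with
the number of generators of `H`. -/
def HasLampQuotients (H : Type*) [Group H] : Prop :=
  ∃ (J E : Type) (_ : Fintype J) (_ : Fintype E) (_ : DecidableEq J) (_ : DecidableEq E)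
    (S : Finset H), closure (S : Set H) = ⊤ ∧ Nonempty J ∧
      S.card < 2 * Fintype.card J + 1 + Fintype.card E ∧
      ∀ m : ℕ, ∃ Φ : H →* Lamp m J E, (Lamp.step m J E ∈ Φ.range) ∧
        (∀ i, Lamp.lampAt m E 0 i ∈ Φ.range) ∧ ∀ i, Lamp.auxAt m J i ∈ Φ.range

/-- On the preimage of `mℤ` the lamplighter's shift is trivial modulo m, so lamp states add. For m ≥
2, two lamp positions, the position divided by m, and the auxiliary part give a map onto an 𝔽₂-space
of dimension 2|J| + 1 + |E|, more than the number of generators of `H`. -/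
theorem HasLampQuotients.not_fixRankBounded_prod {H A : Type*} [Group H] [Group A] [Nontrivial A]
    (hH : HasLampQuotients H) : ¬ FixRankBounded (H × A) := by
  intro hb
  obtain ⟨J, E, _, _, _, _, S, hS, hJ, hcard, hΦ⟩ := hH
  obtain ⟨m, hm, hidx⟩ := exists_index_of_nontrivial A hb
  obtain ⟨Φ, ht, hlamp, haux⟩ := hΦ m
  obtain ⟨T, hT, hmem⟩ := hidx (Lamp.posHom.comp Φ) S hS
  replace hmem : ∀ h, h ∈ closure (T : Set H) ↔ (m : ℤ) ∣ (Φ h).pos := hmem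
  have hconj : ∀ (k : ℤ) (i : J), Lamp.lampAt m E (k : ZMod m) i ∈ Φ.range := fun k i => by
    rw [← Lamp.step_zpow_conj]
    exact mul_mem (mul_mem (zpow_mem ht k) (hlamp i)) (inv_mem (zpow_mem ht k))
  have hval : ∀ x ∈ closure (T : Set H), ∀ y,
      (Φ (x * y)).val = (Φ x).val + (Φ y).val := by
    intro x hx y
    have h0 : (((Φ x).pos : ℤ) : ZMod m) = 0 := (ZMod.intCast_zmod_eq_zero_iff_dvd _ m).2
      ((hmem x).1 hx)
    ext c i
    simp [h0]
  rcases Nat.eq_zero_or_pos m with rfl | hmpos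
  · obtain ⟨i⟩ := hJ
    -- For m = 0 the positions form `ZMod 0 = ℤ`; one lamp type at |S| + 1 positions is already too
    -- much.
    have := card_le_of_closure_eq (F := ZMod 2) (ι := Fin (S.card + 1)) rfl
      (T := T) (fun h c => (Φ h).val ((c : ℕ) : ZMod 0) i) (fun x hx y _ => by
        ext c; simp only [hval x hx y]; rfl) ?_
    · rw [Fintype.card_fin] at this; omega
    · intro c
      obtain ⟨h, hh⟩ := hconj ((c : ℕ) : ℤ) i
      refine Submodule.subset_span ⟨h, (hmem h).2 (by rw [hh]; exact dvd_zero _), ?_⟩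
      ext c'
      simp only [hh, Lamp.lampAt]
      by_cases hc : c' = c
      · subst hc; simp
      · have hne : ((c' : ℕ) : ℤ) ≠ ((c : ℕ) : ℤ) := fun h => hc (Fin.ext (by exact_mod_cast h))
        rw [Pi.single_eq_of_ne hc, Pi.single_eq_of_ne]
        · rfl
        · simpa using hne
  · have hm2 : 2 ≤ m := by omega
    have hmz : (m : ℤ) ≠ 0 := by exact_mod_cast hmpos.ne'
    -- Since m ≥ 2, the positions 0 and 1 are distinct modulo m.
    have hinj : ∀ c c' : Fin 2, ((c : ℕ) : ZMod m) = ((c' : ℕ) : ZMod m) → c = c' := by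
      intro c c' h
      rw [ZMod.natCast_eq_natCast_iff', Nat.mod_eq_of_lt (by omega), Nat.mod_eq_of_lt (by omega)] at h
      exact Fin.ext h
    have := card_le_of_closure_eq (F := ZMod 2) (ι := (Fin 2 × J) ⊕ (Unit ⊕ E)) rfl
      (T := T) (fun h => Sum.elim (fun p => (Φ h).val ((p.1 : ℕ) : ZMod m) p.2)
        (Sum.elim (fun _ => (((Φ h).pos / m : ℤ) : ZMod 2)) (Φ h).aux)) (fun x hx y hy => by
        have hdiv : (Φ (x * y)).pos / m = (Φ x).pos / m + (Φ y).pos / m := by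
          rw [map_mul, Lamp.mul_pos, Int.add_ediv_of_dvd_left ((hmem x).1 hx)]
        ext (p | u | e)
        · simp only [hval x hx y]; rfl
        · simp only [hdiv, Sum.elim_inr, Sum.elim_inl, Pi.add_apply]; push_cast; rfl
        · simp) ?_
    · simp only [Fintype.card_sum, Fintype.card_prod, Fintype.card_fin, Fintype.card_unit] at this
      omega
    · rintro (⟨c, i⟩ | u | e)
      · obtain ⟨h, hh⟩ := hconj ((c : ℕ) : ℤ) i
        refine Submodule.subset_span ⟨h, (hmem h).2 (by rw [hh]; exact dvd_zero _), ?_⟩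
        ext (⟨c', i'⟩ | u | e)
        · simp only [hh, Lamp.lampAt, Sum.elim_inl]
          by_cases hc : c' = c
          · subst hc
            by_cases hi : i' = i
            · subst hi; simp
            · simp [hi]
          · have hne : ((c' : ℕ) : ZMod m) ≠ ((c : ℕ) : ZMod m) := fun h => hc (hinj _ _ h)
            rw [Pi.single_eq_of_ne (by simpa using hne), Pi.single_eq_of_ne (by simp [hc])]
            rfl
        · simp [hh, Lamp.lampAt]
        · simp [hh, Lamp.lampAt]
      · obtain ⟨h, hh⟩ := zpow_mem ht (m : ℤ)
        rw [Lamp.step_zpow] at hh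
        refine Submodule.subset_span ⟨h, (hmem h).2 (by rw [hh]), ?_⟩
        ext (p | u | e)
        · simp [hh]
        · simp only [hh, Int.ediv_self hmz, Sum.elim_inr, Sum.elim_inl]; simp
        · simp [hh]
      · obtain ⟨h, hh⟩ := haux e
        refine Submodule.subset_span ⟨h, (hmem h).2 (by rw [hh]; exact dvd_zero _), ?_⟩
        ext (p | u | e')
        · simp [hh, Lamp.auxAt]
        · simp [hh, Lamp.auxAt]
        · by_cases he : e' = e
          · subst he; simp [hh, Lamp.auxAt]
          · simp [hh, Lamp.auxAt, he]

/-! ### Lamplighter quotients of free and surface groups -/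

theorem exists_finset_closure_presentedGroup {α : Type*} [Fintype α] (rels : Set (FreeGroup α)) :
    ∃ S : Finset (PresentedGroup rels), S.card ≤ Fintype.card α ∧
      closure (S : Set (PresentedGroup rels)) = ⊤ := by
  classical
  exact ⟨Finset.univ.image PresentedGroup.of, Finset.card_image_le,
    by simp [PresentedGroup.closure_range_of rels]⟩

theorem lift_orientableRelator {G : Type*} [Group G] {g : ℕ} (f : Fin g ⊕ Fin g → G) :
    FreeGroup.lift f (orientableRelator g) =
      (List.ofFn fun i => f (.inl i) * f (.inr i) * (f (.inl i))⁻¹ * (f (.inr i))⁻¹).prod := by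
  rw [orientableRelator, map_list_prod, List.map_ofFn]
  congr 2
  ext i
  simp

theorem lift_nonorientableRelator {G : Type*} [Group G] {k : ℕ} (f : Fin k → G) :
    FreeGroup.lift f (nonorientableRelator k) = (List.ofFn fun i => f i ^ 2).prod := by
  rw [nonorientableRelator, map_list_prod, List.map_ofFn]
  congr 2
  ext i
  simp

theorem prod_ofFn_eq_one {G : Type*} [Monoid G] {n : ℕ} (f : Fin n → G) (h : ∀ i, f i = 1) :
    (List.ofFn f).prod = 1 :=
  List.prod_eq_one fun x hx => by
    obtain ⟨i, rfl⟩ := List.mem_ofFn.1 hx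
    exact h i

/-- The homomorphism out of `S_g` given by images of the generators with commuting pairs. -/
theorem exists_hom_orientable {G : Type*} [Group G] {g : ℕ} (f : Fin g ⊕ Fin g → G)
    (h : ∀ i, Commute (f (.inl i)) (f (.inr i))) :
    ∃ Φ : OrientableSurfaceGroup g →* G, ∀ x, Φ (PresentedGroup.of x) = f x := by
  have hrel : ∀ r ∈ ({orientableRelator g} : Set _), FreeGroup.lift f r = 1 := by
    rintro _ rfl
    rw [lift_orientableRelator]
    refine prod_ofFn_eq_one _ fun i => ?_
    rw [(h i).eq]; group
  exact ⟨PresentedGroup.toGroup hrel, fun x => PresentedGroup.toGroup.of hrel⟩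

theorem exists_hom_nonorientable {G : Type*} [Group G] {k : ℕ} (f : Fin k → G)
    (h : (List.ofFn fun i => f i ^ 2).prod = 1) :
    ∃ Φ : NonorientableSurfaceGroup k →* G, ∀ x, Φ (PresentedGroup.of x) = f x := by
  have hrel : ∀ r ∈ ({nonorientableRelator k} : Set _), FreeGroup.lift f r = 1 := by
    rintro _ rfl
    rwa [lift_nonorientableRelator]
  exact ⟨PresentedGroup.toGroup hrel, fun x => PresentedGroup.toGroup.of hrel⟩

/-- One generator steps and the other r − 1 are lamps; r < 2(r − 1) + 1 exactly when r ≥ 2. -/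
theorem hasLampQuotients_freeGroup {r : ℕ} (hr : 2 ≤ r) : HasLampQuotients (FreeGroup (Fin r)) := by
  obtain ⟨j, rfl⟩ := Nat.exists_eq_add_of_le' (show 1 ≤ r by omega)
  refine ⟨Fin j, Fin 0, inferInstance, inferInstance, inferInstance, inferInstance,
    Finset.univ.image FreeGroup.of, by simp [FreeGroup.closure_range_of],
    ⟨⟨0, by omega⟩⟩, Finset.card_image_le.trans_lt (by simp; omega), fun m => ?_⟩
  refine ⟨FreeGroup.lift (Fin.cons (Lamp.step m _ _) fun i => Lamp.lampAt m _ 0 i),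
    ⟨.of 0, by simp⟩, fun i => ⟨.of i.succ, by simp⟩, fun i => i.elim0⟩

theorem hasLampQuotients_orientable {g : ℕ} (hg : 2 ≤ g) :
    HasLampQuotients (OrientableSurfaceGroup g) := by
  obtain ⟨S, hS, hcl⟩ := exists_finset_closure_presentedGroup ({orientableRelator g} : Set _)
  obtain ⟨j, rfl⟩ := Nat.exists_eq_add_of_le' (show 1 ≤ g by omega)
  refine ⟨Fin j ⊕ Fin j, Fin 0, inferInstance, inferInstance, inferInstance, inferInstance,
    S, hcl, ⟨.inl ⟨0, by omega⟩⟩, hS.trans_lt (by simp; omega), fun m => ?_⟩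
  -- The first pair goes to (step, 1) and the others to lamps at 0, so all pairs commute. The count
  -- is 2g < 4(g − 1) + 1.
  obtain ⟨Φ, hΦ⟩ := exists_hom_orientable (G := Lamp m (Fin j ⊕ Fin j) (Fin 0))
    (Sum.elim (Fin.cons (Lamp.step m _ _) fun i => Lamp.lampAt m _ 0 (.inl i))
      (Fin.cons 1 fun i => Lamp.lampAt m _ 0 (.inr i))) (by
      intro i
      refine Fin.cases ?_ (fun i => ?_) i
      · simp
      · ext <;> simp [Lamp.lampAt, add_comm])
  exact ⟨Φ, ⟨_, (hΦ (.inl 0)).trans (by simp)⟩, Sum.rec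
    (fun i => ⟨_, (hΦ (.inl i.succ)).trans (by simp)⟩)
    (fun i => ⟨_, (hΦ (.inr i.succ)).trans (by simp)⟩), fun i => i.elim0⟩

theorem hasLampQuotients_nonorientable {k : ℕ} (hk : 3 ≤ k) :
    HasLampQuotients (NonorientableSurfaceGroup k) := by
  obtain ⟨S, hS, hcl⟩ := exists_finset_closure_presentedGroup ({nonorientableRelator k} : Set _)
  obtain ⟨j, rfl⟩ := Nat.exists_eq_add_of_le' (show 2 ≤ k by omega)
  refine ⟨Fin j, Fin 1, inferInstance, inferInstance, inferInstance, inferInstance,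
    S, hcl, ⟨⟨0, by omega⟩⟩, hS.trans_lt (by simp; omega), fun m => ?_⟩
  -- The squares of the first two images cancel and lamps are involutions, so the relator dies. The
  -- auxiliary bit gives k < 2(k − 2) + 1 + 1; without it the count fails at k = 3.
  obtain ⟨Φ, hΦ⟩ := exists_hom_nonorientable (G := Lamp m (Fin j) (Fin 1))
    (Fin.cons (Lamp.step m _ _) (Fin.cons ⟨0, -1, Pi.single 0 1⟩ fun i => Lamp.lampAt m _ 0 i)) (by
      rw [List.ofFn_succ, List.prod_cons, List.ofFn_succ, List.prod_cons, prod_ofFn_eq_one]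
      · ext <;> simp [Lamp.step, pow_two, CharTwo.add_self_eq_zero]
      · intro i
        ext c i'
        · simp [Lamp.lampAt, pow_two, CharTwo.add_self_eq_zero]
        · simp [Lamp.lampAt, pow_two]
        · simp [Lamp.lampAt, pow_two])
  refine ⟨Φ, ⟨_, (hΦ 0).trans (by simp)⟩, fun i => ⟨_, (hΦ i.succ.succ).trans (by simp)⟩,
    fun i => ⟨.of 0 * .of 1, ?_⟩⟩
  rw [map_mul, hΦ, hΦ, show (1 : Fin (j + 2)) = Fin.succ 0 from rfl, Subsingleton.elim i 0]
  ext <;> simp [Lamp.step, Lamp.auxAt]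

/-! ### The infinite dihedral obstruction -/

/-- The homomorphism from the infinite dihedral group sending reflections to `s`. -/
def reflectionHom {A : Type*} [Group A] (s : A) (hs : s * s = 1) : DihedralGroup 0 →* A where
  toFun
    | .r _ => 1
    | .sr _ => s
  map_one' := rfl
  map_mul' := by rintro (i | i) (j | j) <;> simp [hs]

/-- The amount of a rotation in the infinite dihedral group. -/
def rotationAmount : DihedralGroup 0 → ℤ
  | .r i => i
  | .sr _ => 0

theorem rotationAmount_r_add (i j : ZMod 0) :
    rotationAmount (.r (i + j)) = rotationAmount (.r i) + rotationAmount (.r j) := rfl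

theorem rotationAmount_r_neg (i : ZMod 0) :
    rotationAmount (.r (-i)) = -rotationAmount (.r i) := rfl

theorem rotationAmount_r_one : rotationAmount (.r 1) = 1 := rfl

theorem rotationAmount_one : rotationAmount 1 = 0 := rfl

/-- Multiplying the `A`-coordinate by `s` over reflections fixes exactly the elements lying over
rotations. In `K = ⟨y, a⟩` these include y, aya⁻¹ and a², which (rotation, `χ`, `α`) sends to
(1,1,0), (−1,1,0), (0,0,2), a basis of ℚ³. -/
theorem not_fixRankBounded_of_dihedral {D A : Type*} [Group D] [CommGroup A] {s : A} (hs : s ≠ 1)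
    (hss : s * s = 1) (β : D →* DihedralGroup 0) (χ α : D →* Multiplicative ℤ) (y a : D)
    (hβy : β y = .r 1) (hβa : β a = .sr 0) (hχy : χ y = .ofAdd 1) (hχa : χ a = 1)
    (hαy : α y = 1) (hαa : α a = .ofAdd 1) : ¬ FixRankBounded (D × A) := by
  classical
  intro hb
  let σ := (reflectionHom s hss).comp β
  have hσ : ∀ g, σ g * σ g = 1 := fun g => by
    change reflectionHom s hss (β g) * reflectionHom s hss (β g) = 1
    rcases β g with i | i
    · exact mul_one 1
    · exact hss
  let φ : MulAut (D × A) :=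
    { toFun := fun p => (p.1, p.2 * σ p.1)
      invFun := fun p => (p.1, p.2 * σ p.1)
      left_inv := fun p => by simp [mul_assoc, hσ]
      right_inv := fun p => by simp [mul_assoc, hσ]
      map_mul' := fun p q => by simp [mul_mul_mul_comm] }
  have hφ : ∀ p, p ∈ fixedSubgroup φ ↔ ∃ i, β p.1 = .r i := by
    intro p
    have h1 : p ∈ fixedSubgroup φ ↔ reflectionHom s hss (β p.1) = 1 := by
      rw [mem_fixedSubgroup]
      change (p.1, p.2 * reflectionHom s hss (β p.1)) = p ↔ _
      simp [Prod.ext_iff]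
    rw [h1]
    rcases β p.1 with i | i
    · exact ⟨fun _ => ⟨i, rfl⟩, fun _ => rfl⟩
    · exact ⟨fun h => (hs h).elim, by simp⟩
  obtain ⟨T, hT, hcl⟩ := hb φ {(y, 1), (a, 1)}
  let f : D × A → Fin 3 → ℚ := fun p =>
    ![rotationAmount (β p.1), ((χ p.1).toAdd : ℤ), ((α p.1).toAdd : ℤ)]
  have h2 : (({(y, 1), (a, 1)} : Finset (D × A)) : Set (D × A)) = {(y, 1), (a, 1)} := by simp
  rw [h2] at hcl
  have hy : ((y, 1) : D × A) ∈ closure ({(y, 1), (a, 1)} : Set (D × A)) :=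
    subset_closure (by simp)
  have ha : ((a, 1) : D × A) ∈ closure ({(y, 1), (a, 1)} : Set (D × A)) :=
    subset_closure (by simp)
  have hcard := card_le_of_closure_eq hcl f ?_ ?_
  · have := hcard.trans (hT.trans Finset.card_le_two)
    simp at this
  · rintro p ⟨-, hp⟩ q ⟨-, hq⟩
    obtain ⟨i, hi⟩ := (hφ p).1 hp
    obtain ⟨j, hj⟩ := (hφ q).1 hq
    ext k
    fin_cases k
    · simp [f, hi, hj, rotationAmount_r_add]
    · simp [f]
    · simp [f]
  · have mem : ∀ p ∈ closure ({(y, 1), (a, 1)} : Set (D × A)), (∃ i, β p.1 = .r i) →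
        f p ∈ Submodule.span ℚ (f '' (closure {(y, 1), (a, 1)} ⊓ fixedSubgroup φ :
          Subgroup (D × A))) :=
      fun p hp hp' => Submodule.subset_span ⟨p, ⟨hp, (hφ p).2 hp'⟩, rfl⟩
    have v1 := mem _ hy ⟨1, hβy⟩
    have v2 := mem _ (mul_mem (mul_mem ha hy) (inv_mem ha)) ⟨-1, by simp [hβy, hβa]⟩
    have v3 := mem _ (mul_mem ha ha) ⟨0, by simp [hβa]⟩
    have e1 : f (y, 1) = ![1, 1, 0] := by simp [f, hβy, hχy, hαy, rotationAmount_r_one]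
    have e2 : f ((a, 1) * (y, 1) * (a, 1)⁻¹) = ![-1, 1, 0] := by
      simp [f, hβy, hχy, hαy, hβa, hχa, hαa, rotationAmount_r_neg, rotationAmount_r_one]
    have e3 : f ((a, 1) * (a, 1)) = ![0, 0, 2] := by
      simp [f, hβa, hχa, hαa, rotationAmount_one]
    rw [e1] at v1
    rw [e2] at v2
    rw [e3] at v3
    intro i
    fin_cases i
    · convert Submodule.smul_mem _ (1 / 2 : ℚ) (Submodule.sub_mem _ v1 v2) using 1
      ext k; fin_cases k <;> norm_num
    · convert Submodule.smul_mem _ (1 / 2 : ℚ) (Submodule.add_mem _ v1 v2) using 1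
      ext k; fin_cases k <;> norm_num
    · convert Submodule.smul_mem _ (1 / 2 : ℚ) v3 using 1
      ext k; fin_cases k <;> norm_num

/-! ### Euclidean factors -/

/-- Products of copies of `NS_2`, `ℤ` and `ℤ/2`. -/
def IsEuclidean (A : Type*) [Group A] : Prop :=
  ∃ l p q : ℕ, Nonempty (A ≃* (Fin l → NonorientableSurfaceGroup 2) × ZPow p × ZTwoPow q)

theorem IsEuclidean.pi {n : ℕ} {G : Fin n → Type*} [∀ i, Group (G i)]
    (h : ∀ i, IsEuclidean (G i)) : IsEuclidean (∀ i, G i) := by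
  choose l p q e using h
  let e' : (∀ i, (Fin (l i) → NonorientableSurfaceGroup 2) × ZPow (p i) × ZTwoPow (q i)) ≃*
      ((Σ i, Fin (l i)) → NonorientableSurfaceGroup 2) ×
        ((Σ i, Fin (p i)) → Multiplicative ℤ) × ((Σ i, Fin (q i)) → Multiplicative (ZMod 2)) :=
    { toFun := fun x => (fun s => (x s.1).1 s.2, fun s => (x s.1).2.1 s.2,
        fun s => (x s.1).2.2 s.2)
      invFun := fun y i => (fun k => y.1 ⟨i, k⟩, fun k => y.2.1 ⟨i, k⟩, fun k => y.2.2 ⟨i, k⟩)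
      left_inv := fun _ => rfl
      right_inv := fun _ => rfl
      map_mul' := fun _ _ => rfl }
  exact ⟨_, _, _, ⟨((MulEquiv.piCongrRight fun i => (e i).some).trans e').trans
    (MulEquiv.prodCongr (MulEquiv.arrowCongr (Fintype.equivFin _) (MulEquiv.refl _))
      (MulEquiv.prodCongr (MulEquiv.arrowCongr (Fintype.equivFin _) (MulEquiv.refl _))
        (MulEquiv.arrowCongr (Fintype.equivFin _) (MulEquiv.refl _))))⟩⟩

theorem isEuclidean_of_zPow {A : Type*} [Group A] {p : ℕ} (e : A ≃* ZPow p) : IsEuclidean A :=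
  ⟨0, p, 0, ⟨(e.trans MulEquiv.prodUnique.symm).trans MulEquiv.uniqueProd.symm⟩⟩

theorem isEuclidean_of_zTwoPow {A : Type*} [Group A] {q : ℕ} (e : A ≃* ZTwoPow q) :
    IsEuclidean A :=
  ⟨0, 0, q, ⟨(e.trans (MulEquiv.uniqueProd (M := ZTwoPow q) (N := ZPow 0)).symm).trans
    MulEquiv.uniqueProd.symm⟩⟩

theorem isEuclidean_of_nonorientable_two {A : Type*} [Group A]
    (e : A ≃* NonorientableSurfaceGroup 2) : IsEuclidean A :=
  ⟨1, 0, 0, ⟨((e.trans (MulEquiv.funUnique (Fin 1) _).symm).trans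
    (MulEquiv.prodUnique (N := ZPow 0)).symm).trans
    ((MulEquiv.refl _).prodCongr MulEquiv.prodUnique.symm)⟩⟩

/-- The free group of rank one is infinite cyclic. -/
def freeGroupOneEquiv : FreeGroup (Fin 1) ≃* ZPow 1 :=
  (MonoidHom.toMulEquiv (FreeGroup.lift fun _ => Multiplicative.ofAdd (1 : ℤ))
    (zpowersHom _ (FreeGroup.of 0))
    (by ext i; simp [Subsingleton.elim i 0])
    (by ext; simp)).trans (MulEquiv.funUnique (Fin 1) _).symm

theorem of_mul_of_comm_orientable_one :
    (PresentedGroup.of (.inl 0) * PresentedGroup.of (.inr 0) : OrientableSurfaceGroup 1) =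
      PresentedGroup.of (.inr 0) * PresentedGroup.of (.inl 0) := by
  have h : PresentedGroup.mk {orientableRelator 1} (orientableRelator 1) = 1 :=
    PresentedGroup.one_of_mem rfl
  rw [orientableRelator, List.ofFn_succ, List.ofFn_zero, List.prod_singleton] at h
  exact mul_inv_eq_iff_eq_mul.1 (mul_inv_eq_one.1 h)

theorem nonempty_orientable_one_equiv : Nonempty (OrientableSurfaceGroup 1 ≃* ZPow 2) := by
  obtain ⟨f, hf⟩ := exists_hom_orientable (G := ZPow 2) (g := 1)
    (Sum.elim (fun _ => Pi.mulSingle 0 (.ofAdd 1)) (fun _ => Pi.mulSingle 1 (.ofAdd 1)))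
    fun i => Commute.all _ _
  have hc : Commute (PresentedGroup.of (.inl 0) : OrientableSurfaceGroup 1)
      (PresentedGroup.of (.inr 0)) := of_mul_of_comm_orientable_one
  let g : ZPow 2 →* OrientableSurfaceGroup 1 := MonoidHom.mk'
    (fun x => PresentedGroup.of (.inl 0) ^ (x 0).toAdd * PresentedGroup.of (.inr 0) ^ (x 1).toAdd)
    (fun x y => by
      simp only [Pi.mul_apply, toAdd_mul, zpow_add]
      exact (hc.zpow_zpow _ _).mul_mul_mul_comm _ _)
  refine ⟨MonoidHom.toMulEquiv f g (PresentedGroup.ext fun x => ?_) (MonoidHom.ext fun x => ?_)⟩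
  · rcases x with i | i <;> simp [hf, g, Subsingleton.elim i 0]
  · change f (_ * _) = x
    rw [map_mul, map_zpow, map_zpow, hf, hf]
    ext i
    fin_cases i <;> simp [← ofAdd_zsmul]

theorem nonempty_nonorientable_one_equiv :
    Nonempty (NonorientableSurfaceGroup 1 ≃* ZTwoPow 1) := by
  obtain ⟨f, hf⟩ := exists_hom_nonorientable (G := Multiplicative (ZMod 2)) (k := 1)
    (fun _ => .ofAdd 1) (by simp; rfl)
  have hsq : (PresentedGroup.of 0 : NonorientableSurfaceGroup 1) ^ 2 = 1 := by
    have h : PresentedGroup.mk {nonorientableRelator 1} (nonorientableRelator 1) = 1 :=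
      PresentedGroup.one_of_mem rfl
    have h' : nonorientableRelator 1 = FreeGroup.of 0 ^ 2 := by simp [nonorientableRelator]
    rwa [congrArg (PresentedGroup.mk {nonorientableRelator 1}) h', map_pow] at h
  have hz : ∀ x : NonorientableSurfaceGroup 1, ∃ k : ℤ, PresentedGroup.of 0 ^ k = x := by
    intro x
    rw [← mem_zpowers_iff]
    refine PresentedGroup.generated_by _ _ (fun i => ?_) x
    rw [Subsingleton.elim i 0]
    exact mem_zpowers _
  refine ⟨(MulEquiv.ofBijective f ⟨?_, ?_⟩).trans (MulEquiv.funUnique (Fin 1) _).symm⟩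
  · rw [injective_iff_map_eq_one]
    intro x hx
    obtain ⟨k, rfl⟩ := hz x
    rw [map_zpow, hf, ← ofAdd_zsmul, ofAdd_eq_one, zsmul_one,
      ZMod.intCast_zmod_eq_zero_iff_dvd] at hx
    obtain ⟨j, rfl⟩ := hx
    rw [zpow_mul]
    erw [zpow_natCast]
    rw [hsq, one_zpow]
  · intro x
    refine ⟨PresentedGroup.of 0 ^ (x.toAdd.val), ?_⟩
    rw [map_pow, hf, ← ofAdd_nsmul]
    simp

/-! ### The Euclidean/hyperbolic dichotomy -/

/-- The factors that are not virtually abelian. -/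
def IsHyperbolicFactor (A : Type*) [Group A] : Prop :=
  (∃ r : ℕ, 2 ≤ r ∧ Nonempty (A ≃* FreeGroup (Fin r))) ∨
  (∃ g : ℕ, 2 ≤ g ∧ Nonempty (A ≃* OrientableSurfaceGroup g)) ∨
  (∃ k : ℕ, 3 ≤ k ∧ Nonempty (A ≃* NonorientableSurfaceGroup k))

theorem IsFactorGroup.isEuclidean_or {A : Type*} [Group A] (h : IsFactorGroup A) :
    IsEuclidean A ∨ IsHyperbolicFactor A := by
  rcases h with ⟨r, hr, ⟨e⟩⟩ | ⟨g, hg, ⟨e⟩⟩ | ⟨k, hk, ⟨e⟩⟩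
  · rcases hr.eq_or_lt with rfl | hr
    · exact .inl (isEuclidean_of_zPow (e.trans freeGroupOneEquiv))
    · exact .inr (.inl ⟨r, hr, ⟨e⟩⟩)
  · rcases hg.eq_or_lt with rfl | hg
    · exact .inl (isEuclidean_of_zPow (e.trans nonempty_orientable_one_equiv.some))
    · exact .inr (.inr (.inl ⟨g, hg, ⟨e⟩⟩))
  · rcases hk.eq_or_lt with rfl | hk
    · exact .inl (isEuclidean_of_zTwoPow (e.trans nonempty_nonorientable_one_equiv.some))
    · rcases (Nat.succ_le_of_lt hk).eq_or_lt with rfl | hk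
      · exact .inl (isEuclidean_of_nonorientable_two e)
      · exact .inr (.inr (.inr ⟨k, hk, ⟨e⟩⟩))

theorem IsFactorGroup.nontrivial {A : Type*} [Group A] (h : IsFactorGroup A) : Nontrivial A := by
  have hne : (Multiplicative.ofAdd (1 : ZMod 2)) ≠ 1 := by decide
  rcases h with ⟨r, hr, ⟨e⟩⟩ | ⟨g, hg, ⟨e⟩⟩ | ⟨k, hk, ⟨e⟩⟩
  · have : Nonempty (Fin r) := ⟨⟨0, hr⟩⟩
    exact e.toEquiv.nontrivial
  · obtain ⟨f, hf⟩ := exists_hom_orientable (g := g)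
      (fun _ => Multiplicative.ofAdd (1 : ZMod 2)) fun _ => Commute.all _ _
    refine @Equiv.nontrivial _ _ e.toEquiv ⟨PresentedGroup.of (.inl ⟨0, hg⟩), 1, fun h => hne ?_⟩
    rw [← hf (.inl ⟨0, hg⟩), h, map_one]
  · obtain ⟨f, hf⟩ := exists_hom_nonorientable (k := k)
      (fun _ => Multiplicative.ofAdd (1 : ZMod 2)) (prod_ofFn_eq_one _ fun _ => by decide)
    refine @Equiv.nontrivial _ _ e.toEquiv ⟨PresentedGroup.of ⟨0, hk⟩, 1, fun h => hne ?_⟩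
    rw [← hf ⟨0, hk⟩, h, map_one]

theorem IsHyperbolicFactor.not_fixRankBounded_prod {A B : Type*} [Group A] [Group B] [Nontrivial B]
    (h : IsHyperbolicFactor A) : ¬ FixRankBounded (A × B) := by
  have transfer : ∀ {H : Type} [Group H], HasLampQuotients H → (A ≃* H) →
      ¬ FixRankBounded (A × B) := fun hH e hb =>
    hH.not_fixRankBounded_prod (hb.congr (e.prodCongr (MulEquiv.refl B)))
  rcases h with ⟨r, hr, ⟨e⟩⟩ | ⟨g, hg, ⟨e⟩⟩ | ⟨k, hk, ⟨e⟩⟩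
  · exact transfer (hasLampQuotients_freeGroup hr) e
  · exact transfer (hasLampQuotients_orientable hg) e
  · exact transfer (hasLampQuotients_nonorientable hk) e

/-- A product of groups splits off each of its factors. -/
def piSplitAtMulEquiv {ι : Type*} [DecidableEq ι] (i : ι) (G : ι → Type*) [∀ j, Group (G j)] :
    (∀ j, G j) ≃* G i × ∀ j : {j // j ≠ i}, G j :=
  { Equiv.piSplitAt i G with map_mul' := fun _ _ => rfl }

/-! ### Classification of the Euclidean products -/

/-- The Klein bottle group acts on the line through the infinite dihedral group, and it maps onto
`ℤ`. -/
theorem exists_homs_nonorientable_two :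
    ∃ (β : NonorientableSurfaceGroup 2 →* DihedralGroup 0)
      (α : NonorientableSurfaceGroup 2 →* Multiplicative ℤ) (x a : NonorientableSurfaceGroup 2),
      β x = .r 1 ∧ β a = .sr 0 ∧ α x = 1 ∧ α a = .ofAdd 1 := by
  obtain ⟨β, hβ⟩ := exists_hom_nonorientable (k := 2)
    (![.sr 0, .sr 1] : Fin 2 → DihedralGroup 0) (by simp [List.ofFn_succ, pow_two])
  obtain ⟨α, hα⟩ := exists_hom_nonorientable (k := 2)
    (![.ofAdd 1, .ofAdd (-1)] : Fin 2 → Multiplicative ℤ) (by simp [List.ofFn_succ])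
  -- The product a₁a₂ becomes a unit translation under `β` and is killed by `α`.
  refine ⟨β, α, .of 0 * .of 1, .of 0, ?_, hβ 0, ?_, hα 0⟩
  · rw [map_mul, hβ, hβ]; simp
  · rw [map_mul, hα, hα]; simp

theorem not_fixRankBounded_euclidean {l p q : ℕ} (hl : 1 ≤ l) (hq : 1 ≤ q)
    (hlp : 2 ≤ l ∨ 1 ≤ p) :
    ¬ FixRankBounded ((Fin l → NonorientableSurfaceGroup 2) × ZPow p × ZTwoPow q) := by
  intro hb
  replace hb := hb.congr (MulEquiv.prodAssoc (M := Fin l → NonorientableSurfaceGroup 2)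
    (N := ZPow p) (P := ZTwoPow q)).symm
  obtain ⟨β, α, x, a, hβx, hβa, hαx, hαa⟩ := exists_homs_nonorientable_two
  let s : ZTwoPow q := Pi.mulSingle ⟨0, hq⟩ (.ofAdd 1)
  have hs : s ≠ 1 := by
    rw [Ne, Pi.mulSingle_eq_one_iff]; decide
  have hss : s * s = 1 := by
    rw [← Pi.mulSingle_mul, Pi.mulSingle_eq_one_iff]; decide
  let π : (Fin l → NonorientableSurfaceGroup 2) × ZPow p →* NonorientableSurfaceGroup 2 :=
    (Pi.evalMonoidHom _ ⟨0, hl⟩).comp (MonoidHom.fst _ _)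
  rcases hlp with hl2 | hp
  -- `χ` must be independent of the first Klein bottle factor: a second copy supplies it here, a ℤ
  -- factor in the other case. Accordingly `y` has a component there with `χ`-value 1.
  · have h01 : (⟨1, hl2⟩ : Fin l) ≠ ⟨0, hl⟩ := by simp
    refine not_fixRankBounded_of_dihedral hs hss (β.comp π)
      (α.comp ((Pi.evalMonoidHom _ ⟨1, hl2⟩).comp (MonoidHom.fst _ _))) (α.comp π)
      (Pi.mulSingle ⟨0, hl⟩ x * Pi.mulSingle ⟨1, hl2⟩ a, 1) (Pi.mulSingle ⟨0, hl⟩ a, 1)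
      ?_ ?_ ?_ ?_ ?_ ?_ hb <;> simp [π, h01, h01.symm, hβx, hβa, hαx, hαa]
  · refine not_fixRankBounded_of_dihedral hs hss (β.comp π)
      ((Pi.evalMonoidHom _ ⟨0, hp⟩).comp (MonoidHom.snd _ _)) (α.comp π)
      (Pi.mulSingle ⟨0, hl⟩ x, Pi.mulSingle ⟨0, hp⟩ (.ofAdd 1)) (Pi.mulSingle ⟨0, hl⟩ a, 1)
      ?_ ?_ ?_ ?_ ?_ ?_ hb <;> simp [π, hβx, hβa, hαx, hαa]

theorem IsEuclidean.classification {G : Type*} [Group G] (h : IsEuclidean G)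
    (hb : FixRankBounded G) : IsEuc1 G ∨ IsEuc2 G ∨ IsEuc4 G := by
  obtain ⟨l, p, q, ⟨e⟩⟩ := h
  rcases Nat.eq_zero_or_pos l with rfl | hl
  · exact .inl ⟨p, q, ⟨e.trans MulEquiv.uniqueProd⟩⟩
  rcases Nat.eq_zero_or_pos q with rfl | hq
  · exact .inr (.inr ⟨l, p, hl, ⟨e.trans ((MulEquiv.refl _).prodCongr MulEquiv.prodUnique)⟩⟩)
  have hlp : ¬ (2 ≤ l ∨ 1 ≤ p) := fun h => not_fixRankBounded_euclidean hl hq h (hb.congr e)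
  obtain rfl : l = 1 := by omega
  obtain rfl : p = 0 := by omega
  exact .inr (.inl ⟨q, ⟨e.trans
    ((MulEquiv.funUnique (Fin 1) _).prodCongr MulEquiv.uniqueProd)⟩⟩)

end ProductGroups

theorem mainTheorem10 {n : ℕ} (hn : 1 ≤ n) (G : Fin n → Type*) [∀ i, Group (G i)]
    (hG : ∀ i, ProductGroups.IsFactorGroup (G i))
    (hinert : ∀ φ : MulAut (∀ i, G i),
      ProductGroups.IsInert (ProductGroups.fixedSubgroup φ)) :
    ProductGroups.IsEuc1 (∀ i, G i) ∨
    ProductGroups.IsEuc2 (∀ i, G i) ∨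
    ProductGroups.IsEuc3 (∀ i, G i) ∨
    ProductGroups.IsEuc4 (∀ i, G i) ∨
    (∃ r : ℕ, 2 ≤ r ∧ Nonempty ((∀ i, G i) ≃* FreeGroup (Fin r))) ∨
    (∃ g : ℕ, 2 ≤ g ∧ Nonempty ((∀ i, G i) ≃* ProductGroups.OrientableSurfaceGroup g)) ∨
    (∃ k : ℕ, 3 ≤ k ∧ Nonempty ((∀ i, G i) ≃* ProductGroups.NonorientableSurfaceGroup k)) := by
  have hb := ProductGroups.fixRankBounded_of_isInert hinert
  by_cases hE : ∀ i, ProductGroups.IsEuclidean (G i)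
  · rcases (ProductGroups.IsEuclidean.pi hE).classification hb with h | h | h
    · exact .inl h
    · exact .inr (.inl h)
    · exact .inr (.inr (.inr (.inl h)))
  · push Not at hE
    obtain ⟨i, hi⟩ := hE
    have hhyp := (hG i).isEuclidean_or.resolve_left hi
    rcases hn.eq_or_lt with rfl | hn
    · obtain rfl : i = 0 := Subsingleton.elim _ _
      let e : (∀ i, G i) ≃* G 0 := MulEquiv.piUnique G
      refine .inr (.inr (.inr (.inr ?_)))
      rcases hhyp with ⟨r, hr, ⟨e'⟩⟩ | ⟨g, hg, ⟨e'⟩⟩ | ⟨k, hk, ⟨e'⟩⟩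
      · exact .inl ⟨r, hr, ⟨e.trans e'⟩⟩
      · exact .inr (.inl ⟨g, hg, ⟨e.trans e'⟩⟩)
      · exact .inr (.inr ⟨k, hk, ⟨e.trans e'⟩⟩)
    -- Splitting off the hyperbolic factor leaves a nontrivial complement, since n ≥ 2 and every
    -- factor is nontrivial.
    · exfalso
      have : Nontrivial (Fin n) := Fin.nontrivial_iff_two_le.2 hn
      obtain ⟨j, hj⟩ := exists_ne i
      have : ∀ j, Nontrivial (G j) := fun j => (hG j).nontrivial
      have : Nontrivial (∀ k : {j // j ≠ i}, G k) := Pi.nontrivial_at ⟨j, hj⟩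
      exact hhyp.not_fixRankBounded_prod (hb.congr (ProductGroups.piSplitAtMulEquiv i G))
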